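/- Let $M,N\ge 1$. A frame for $\mathbb R^N$ is a sequence $\Phi=\{\varphi_i\}_{i=1}^M\subset\mathbb R^N$ with constants $0<A\le B<\infty$ such that $A\|x\|^2\le\sum_i|\langle x,\varphi_i\rangle|^2\le B\|x\|^2$ for all $x$; it is tight if one can take $A=B$, and scalable if there are scalars $s_i\ge 0$ such that $\{s_i\varphi_i\}_{i=1}^M$ is a tight frame. Let $\|\cdot\|_F$ be the Frobenius norm of the $N\times M$ matrix with the given columns, let $d_\Phi=\inf\{\|\Phi-\Psi\|_F:\Psi=\{\psi_i\}_{i=1}^M \text{ a scalable frame for }\mathbb R^N\}$, and let $K=\min\{M,\tfrac{N(N+1)}2\}$. For a positive definite matrix $X$ put $E(X)=\{v\in\mathbb R^N:\langle Xv,v\rangle\le 1\}$. The minimal ellipsoid $E_\Phi$ of $\Phi$ is the ellipsoid (with arbitrary center) of least volume containing the convex hull of $\{\pm\varphi_i\}_{i=1}^M$, and $V_\Phi$ is the volume of $E_\Phi$ divided by that of the unit ball. Theorem. Let $\Phi=\{\varphi_i\}_{i=1}^M$ be a frame of unit vectors for $\mathbb R^N$ with $d_\Phi\le\frac12(1+\sqrt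 K)^{-1}$. Then $E_\Phi=E(X)$ for some positive definite $X$, and there are $\rho_i\ge 0$, at most $K$ of them nonzero, with $X^{-1}=\sum_{i=1}^M\rho_i\varphi_i\varphi_i^T$. For every such choice, the sequence $\widetilde\Phi=\{\tilde\varphi_i\}_{i=1}^M$ given by $\tilde\varphi_i=V_\Phi^{1/N}X^{1/2}\varphi_i$ if $\rho_i>0$ and $\tilde\varphi_i=\varphi_i$ if $\rho_i=0$ is a scalable frame, and $$\|\widetilde\Phi-\Phi\|_F\le\sqrt{KN}\left(1-\sqrt{N\,\frac{(1-d_\Phi)^4-4Kd_\Phi^2}{N(1-d_\Phi)^4-4Kd_\Phi^2}}\right)^{1/2}\le C\,K\sqrt N\,d_\Phi,$$ where $C>0$ is an absolute constant; here the numerator and the denominator of the fraction are positive, and the inner square root is at most $1$. -/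

import Mathlib

open scoped MatrixOrder

noncomputable section

namespace ScalableFrames

/-- A sequence of `M` vectors in `ℝ^N` is a frame if it has frame bounds `0 < A` and `B`. -/
def IsFrame {M N : ℕ} (Φ : Fin M → EuclideanSpace ℝ (Fin N)) : Prop :=
  ∃ A B : ℝ, 0 < A ∧ 0 < B ∧ ∀ x : EuclideanSpace ℝ (Fin N),
    A * ‖x‖ ^ 2 ≤ ∑ i, |inner ℝ x (Φ i)| ^ 2 ∧ ∑ i, |inner ℝ x (Φ i)| ^ 2 ≤ B * ‖x‖ ^ 2

/-- A tight frame: the two frame bounds can be taken equal (and positive). -/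
def IsTightFrame {M N : ℕ} (Φ : Fin M → EuclideanSpace ℝ (Fin N)) : Prop :=
  ∃ A : ℝ, 0 < A ∧ ∀ x : EuclideanSpace ℝ (Fin N),
    ∑ i, |inner ℝ x (Φ i)| ^ 2 = A * ‖x‖ ^ 2

/-- A frame of unit vectors. -/
def IsUnitNormFrame {M N : ℕ} (Φ : Fin M → EuclideanSpace ℝ (Fin N)) : Prop :=
  IsFrame Φ ∧ ∀ i, ‖Φ i‖ = 1

/-- A frame that becomes tight after multiplying its vectors by suitable nonnegative scalars. -/
def IsScalable {M N : ℕ} (Φ : Fin M → EuclideanSpace ℝ (Fin N)) : Prop :=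
  IsFrame Φ ∧ ∃ s : Fin M → ℝ, (∀ i, 0 ≤ s i) ∧ IsTightFrame (fun i => s i • Φ i)

/-- Frobenius norm of the `N × M` matrix whose columns are the given vectors. -/
def frobeniusNorm {M N : ℕ} (Φ : Fin M → EuclideanSpace ℝ (Fin N)) : ℝ :=
  Real.sqrt (∑ i, ‖Φ i‖ ^ 2)

/-- The distance `d_Φ` (in Frobenius norm) of `Φ` to the set of scalable frames. -/
def scalableDist {M N : ℕ} (Φ : Fin M → EuclideanSpace ℝ (Fin N)) : ℝ :=
  sInf {r : ℝ | ∃ Ψ : Fin M → EuclideanSpace ℝ (Fin N),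
    IsScalable Ψ ∧ r = frobeniusNorm (Φ - Ψ)}

/-- The set `E(X, c) = {v : ⟨X (v - c), v - c⟩ ≤ 1}`; an ellipsoid when `X` is positive definite. -/
def ellipsoid {N : ℕ} (X : Matrix (Fin N) (Fin N) ℝ) (c : EuclideanSpace ℝ (Fin N)) :
    Set (EuclideanSpace ℝ (Fin N)) :=
  {v | inner ℝ (Matrix.toEuclideanLin X (v - c)) (v - c) ≤ 1}

/-- `E` is an ellipsoid of minimal volume among all ellipsoids (with arbitrary centers)
containing `S`. -/
structure IsMinimalEllipsoid {N : ℕ} (S E : Set (EuclideanSpace ℝ (Fin N))) : Prop where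
  isEllipsoid : ∃ (X : Matrix (Fin N) (Fin N) ℝ) (c : EuclideanSpace ℝ (Fin N)),
    X.PosDef ∧ E = ellipsoid X c
  subset : S ⊆ E
  volume_le : ∀ (Y : Matrix (Fin N) (Fin N) ℝ) (c : EuclideanSpace ℝ (Fin N)),
    Y.PosDef → S ⊆ ellipsoid Y c →
      MeasureTheory.volume E ≤ MeasureTheory.volume (ellipsoid Y c)

/-- The symmetrized frame `{φ_i} ∪ {-φ_i}`. -/
def symmetrized {M N : ℕ} (Φ : Fin M → EuclideanSpace ℝ (Fin N)) :
    Set (EuclideanSpace ℝ (Fin N)) :=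
  Set.range Φ ∪ Set.range (fun i => -Φ i)

/-- `E` is the minimal ellipsoid of `Φ`, that is, of the convex hull of the symmetrized frame. -/
def IsMinimalEllipsoidOf {M N : ℕ} (Φ : Fin M → EuclideanSpace ℝ (Fin N))
    (E : Set (EuclideanSpace ℝ (Fin N))) : Prop :=
  IsMinimalEllipsoid (convexHull ℝ (symmetrized Φ)) E

/-- Volume divided by the volume `ω_N` of the unit ball. -/
def normalizedVolume {N : ℕ} (E : Set (EuclideanSpace ℝ (Fin N))) : ℝ :=
  (MeasureTheory.volume E).toReal /
    (MeasureTheory.volume (Metric.closedBall (0 : EuclideanSpace ℝ (Fin N)) 1)).toReal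

/-- The number `K = min {M, N (N + 1) / 2}`. -/
def numK (M N : ℕ) : ℕ := min M (N * (N + 1) / 2)

/-- Weights `ρ_i ≥ 0`, at most `K` of them nonzero, with `X⁻¹ = ∑ ρ_i φ_i φ_iᵀ`. -/
structure IsWeight {M N : ℕ} (Φ : Fin M → EuclideanSpace ℝ (Fin N))
    (X : Matrix (Fin N) (Fin N) ℝ) (ρ : Fin M → ℝ) : Prop where
  nonneg : ∀ i, 0 ≤ ρ i
  card_le : (Finset.univ.filter (fun i => 0 < ρ i)).card ≤ numK M N
  inv_eq : X⁻¹ = ∑ i, ρ i • Matrix.vecMulVec (Φ i).ofLp (Φ i).ofLp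

open Classical in
/-- The approximating frame: `φ̃_i = V^{1/N} X^{1/2} φ_i` if `ρ_i > 0`, and `φ̃_i = φ_i` otherwise,
where `V` is the normalized volume of `E(X)` and `X^{1/2}` is the positive square root. -/
def approxFrame {M N : ℕ} (Φ : Fin M → EuclideanSpace ℝ (Fin N))
    (X : Matrix (Fin N) (Fin N) ℝ) (ρ : Fin M → ℝ) : Fin M → EuclideanSpace ℝ (Fin N) :=
  fun i =>
    if 0 < ρ i then
      (normalizedVolume (ellipsoid X 0) ^ (1 / (N : ℝ))) •
        Matrix.toEuclideanLin (CFC.sqrt X) (Φ i)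
    else Φ i

/-- The numerator `(1 - d)^4 - 4 K d²`. -/
def boundNum (K : ℕ) (d : ℝ) : ℝ := (1 - d) ^ 4 - 4 * K * d ^ 2

/-- The denominator `N (1 - d)^4 - 4 K d²`. -/
def boundDen (K N : ℕ) (d : ℝ) : ℝ := N * (1 - d) ^ 4 - 4 * K * d ^ 2

/-- The error bound, as a function of `K`, `N` and `d`. -/
def errorBound (K N : ℕ) (d : ℝ) : ℝ :=
  Real.sqrt (K * N) * Real.sqrt (1 - Real.sqrt (N * (boundNum K d / boundDen K N d)))

end ScalableFrames

end

/-!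
The origin-centred ellipsoid `E(X)` has normalized volume `(det X)^(-1/2)`, and it encloses `Φ` iff
`φᵀ X φ ≤ 1` for all `φ` in `Φ`. For nonnegative weights `w` of total mass `N` and
`S = ∑ wᵢ φᵢ φᵢᵀ`, this gives `tr (X S) ≤ N`, hence `det X * det S ≤ 1` by AM-GM. If `w` maximizes
`det S`, first order optimality says that `X = S⁻¹` encloses `Φ` (Kiefer-Wolfowitz), so equality
holds. The equality case of AM-GM then gives `X⁻¹ = S` and `tr X⁻¹ = N` for the minimal ellipsoid,
and Carathéodory's theorem makes the weights sparse.

A scalable `Ψ` supplies weights with `tr S = N` and `‖S - 1‖² ≤ 2 N ‖Φ - Ψ‖²`, and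
`det S ≥ 1 - ‖S - 1‖²` for such `S`, so `V² = det X⁻¹ ≥ 1 - 2 N d²`. Finally, put `v = V^(1/N)` and
`ψ = X^(1/2) φ`. When `φ` carries positive weight, `ψ` is a unit vector by complementary slackness,
so `‖v X^(1/2) φ - φ‖ ≤ ‖v - X^(-1/2)‖`, whose square is at most `N (1 - v²)` because
`tr X^(-1/2) ≥ N v`.
-/

namespace ScalableFrames

open Matrix

section RealInequalities

variable {ι : Type*}

theorem one_sub_sum_le_prod_one_sub (s : Finset ι) {a : ι → ℝ} (h₀ : ∀ i ∈ s, 0 ≤ a i)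
    (h₁ : ∀ i ∈ s, a i ≤ 1) : 1 - ∑ i ∈ s, a i ≤ ∏ i ∈ s, (1 - a i) := by
  induction s using Finset.cons_induction with
  | empty => simp
  | cons j s hj ih =>
    rw [Finset.forall_mem_cons] at h₀ h₁
    rw [Finset.sum_cons, Finset.prod_cons]
    have hsum : 0 ≤ ∑ i ∈ s, a i := Finset.sum_nonneg h₀.2
    nlinarith [ih h₀.2 h₁.2, h₀.1, h₁.1]

theorem one_sub_sq_mul_exp_le {y : ℝ} (hy : -1 ≤ y) : (1 - y ^ 2) * Real.exp y ≤ 1 + y := by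
  have h : (1 - y) * Real.exp y ≤ 1 := by
    calc (1 - y) * Real.exp y ≤ Real.exp (-y) * Real.exp y :=
          mul_le_mul_of_nonneg_right (Real.one_sub_le_exp_neg y) (Real.exp_pos y).le
      _ = 1 := by rw [← Real.exp_add, neg_add_cancel, Real.exp_zero]
  nlinarith

theorem one_sub_sum_sq_le_prod_one_add (s : Finset ι) {y : ι → ℝ} (hy : ∀ i ∈ s, -1 ≤ y i)
    (hsum : ∑ i ∈ s, y i = 0) : 1 - ∑ i ∈ s, y i ^ 2 ≤ ∏ i ∈ s, (1 + y i) := by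
  rcases le_total (∑ i ∈ s, y i ^ 2) 1 with h | h
  · have hsq : ∀ i ∈ s, y i ^ 2 ≤ 1 := fun i hi =>
      (Finset.single_le_sum (fun j _ => sq_nonneg (y j)) hi).trans h
    calc 1 - ∑ i ∈ s, y i ^ 2
        ≤ ∏ i ∈ s, (1 - y i ^ 2) :=
          one_sub_sum_le_prod_one_sub s (fun i _ => sq_nonneg (y i)) hsq
      _ = ∏ i ∈ s, (1 - y i ^ 2) * Real.exp (y i) := by
          rw [Finset.prod_mul_distrib, ← Real.exp_sum, hsum, Real.exp_zero, mul_one]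
      _ ≤ ∏ i ∈ s, (1 + y i) := Finset.prod_le_prod
          (fun i hi => mul_nonneg (sub_nonneg.2 (hsq i hi)) (Real.exp_pos _).le)
          (fun i hi => one_sub_sq_mul_exp_le (hy i hi))
  · exact (sub_nonpos.2 h).trans (Finset.prod_nonneg fun i hi => by linarith [hy i hi])

theorem le_of_forall_one_add_mul_le_one_add_pow {q : ℝ} {n : ℕ}
    (h : ∀ s : ℝ, 0 < s → 1 + s * q ≤ (1 + s) ^ n) : q ≤ n := by
  have hderiv : HasDerivAt (fun s : ℝ => (1 + s) ^ n) n 0 := by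
    simpa using ((hasDerivAt_id (0 : ℝ)).const_add 1).fun_pow n
  have hslope := hderiv.tendsto_slope_zero_right
  refine ge_of_tendsto hslope (eventually_nhdsWithin_of_forall fun s (hs : 0 < s) => ?_)
  rw [smul_eq_mul, inv_mul_eq_div, le_div_iff₀ hs]
  simpa [mul_comm s q, le_sub_iff_add_le'] using h s hs

end RealInequalities

section Frobenius

open scoped Matrix.Norms.Frobenius

variable {m n : Type*} [Fintype m] [Fintype n]

theorem frobenius_norm_sq_eq_trace (A : Matrix m n ℝ) : ‖A‖ ^ 2 = (Aᵀ * A).trace := by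
  rw [frobenius_norm_def, ← Real.sqrt_eq_rpow, Real.sq_sqrt (by positivity), Finset.sum_comm]
  simp [trace, mul_apply, sq]

theorem norm_toEuclideanLin_le [DecidableEq n] (A : Matrix n n ℝ) (x : EuclideanSpace ℝ n) :
    ‖toEuclideanLin A x‖ ≤ ‖A‖ * ‖x‖ := by
  simpa [toLpLin_apply, ← replicateCol_mulVec, frobenius_norm_replicateCol] using
    frobenius_norm_mul A (replicateCol Unit x.ofLp)

variable [DecidableEq n] {S : Matrix n n ℝ}

theorem frobenius_norm_smul_one_sub_sq (hS : S.IsSymm) (v : ℝ) :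
    ‖v • 1 - S‖ ^ 2 = Fintype.card n * v ^ 2 - 2 * v * S.trace + (S * S).trace := by
  rw [frobenius_norm_sq_eq_trace, transpose_sub, transpose_smul, transpose_one, hS.eq]
  simp only [sub_mul, mul_sub, smul_mul_assoc, mul_smul_comm, one_mul, mul_one, trace_sub,
    trace_smul, trace_one, smul_eq_mul]
  ring

theorem frobenius_norm_sub_one_sq_eq_sum_eigenvalues (hS : S.IsHermitian) :
    ‖S - 1‖ ^ 2 = ∑ i, (hS.eigenvalues i - 1) ^ 2 := by
  have hdiag : S - 1 = Unitary.conjStarAlgAut ℝ _ hS.eigenvectorUnitary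
      (diagonal fun i => hS.eigenvalues i - 1) := by
    conv_lhs => rw [hS.spectral_theorem, ← map_one
      (Unitary.conjStarAlgAut ℝ (Matrix n n ℝ) hS.eigenvectorUnitary), ← map_sub, ← diagonal_one,
      diagonal_sub]
    rfl
  have hsymm : (S - 1)ᵀ = S - 1 := by
    rw [transpose_sub, transpose_one, ← conjTranspose_eq_transpose_of_trivial, hS.eq]
  rw [frobenius_norm_sq_eq_trace, hsymm, hdiag, ← map_mul, Unitary.conjStarAlgAut_apply,
    trace_mul_comm, ← mul_assoc, Unitary.coe_star_mul_self, one_mul, diagonal_mul_diagonal,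
    trace_diagonal]
  simp only [sq]

end Frobenius

section DeterminantTrace

open scoped Matrix.Norms.Frobenius

variable {n : Type*} [Fintype n] [DecidableEq n] {S : Matrix n n ℝ}

theorem det_le_exp_trace_sub_card (hS : S.PosSemidef) :
    S.det ≤ Real.exp (S.trace - Fintype.card n) := by
  calc S.det = ∏ i, hS.isHermitian.eigenvalues i := hS.isHermitian.det_eq_prod_eigenvalues
    _ ≤ ∏ i, Real.exp (hS.isHermitian.eigenvalues i - 1) :=
        Finset.prod_le_prod (fun i _ => hS.eigenvalues_nonneg i) fun i _ => by
          linarith [Real.add_one_le_exp (hS.isHermitian.eigenvalues i - 1)]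
    _ = Real.exp (S.trace - Fintype.card n) := by
        rw [← Real.exp_sum, Finset.sum_sub_distrib, hS.isHermitian.trace_eq_sum_eigenvalues]
        simp

theorem det_le_one_of_trace_le (hS : S.PosSemidef) (htr : S.trace ≤ Fintype.card n) :
    S.det ≤ 1 :=
  (det_le_exp_trace_sub_card hS).trans (Real.exp_le_one_iff.2 (sub_nonpos.2 htr))

theorem eq_one_of_one_le_det_of_trace_le (hS : S.PosSemidef) (hdet : 1 ≤ S.det)
    (htr : S.trace ≤ Fintype.card n) : S = 1 := by
  by_contra hne
  have hprod : S.det = ∏ i, hS.isHermitian.eigenvalues i :=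
    hS.isHermitian.det_eq_prod_eigenvalues
  have hpos : ∀ i, 0 < hS.isHermitian.eigenvalues i := fun i =>
    (hS.eigenvalues_nonneg i).lt_of_ne' fun h => by
      linarith [hprod.trans (Finset.prod_eq_zero (Finset.mem_univ i) h)]
  obtain ⟨j, hj⟩ : ∃ j, hS.isHermitian.eigenvalues j - 1 ≠ 0 := by
    by_contra! h
    refine hne (sub_eq_zero.1 (norm_eq_zero.1 (pow_eq_zero_iff two_ne_zero |>.1 ?_)))
    simp [frobenius_norm_sub_one_sq_eq_sum_eigenvalues hS.isHermitian, h]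
  have hlt : S.det < ∏ i, Real.exp (hS.isHermitian.eigenvalues i - 1) := by
    rw [hprod]
    refine Finset.prod_lt_prod (fun i _ => hpos i) (fun i _ => ?_) ⟨j, Finset.mem_univ j, ?_⟩
    · linarith [Real.add_one_le_exp (hS.isHermitian.eigenvalues i - 1)]
    · linarith [Real.add_one_lt_exp hj]
  rw [← Real.exp_sum, Finset.sum_sub_distrib] at hlt
  have htr' : S.trace = ∑ i, hS.isHermitian.eigenvalues i :=
    hS.isHermitian.trace_eq_sum_eigenvalues
  have hexp : Real.exp (∑ i, hS.isHermitian.eigenvalues i - ∑ _i : n, (1 : ℝ)) ≤ 1 := by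
    rw [Real.exp_le_one_iff, ← htr']
    simpa using htr
  linarith

theorem card_mul_le_trace_of_det_eq_pow (hS : S.PosSemidef) {v : ℝ} (hv : 0 < v)
    (hdet : S.det = v ^ Fintype.card n) : Fintype.card n * v ≤ S.trace := by
  have h := det_le_exp_trace_sub_card (hS.smul (inv_nonneg.2 hv.le))
  rw [det_smul, hdet, ← mul_pow, inv_mul_cancel₀ hv.ne', one_pow, Real.one_le_exp_iff,
    sub_nonneg, trace_smul, smul_eq_mul, inv_mul_eq_div, le_div_iff₀ hv] at h
  exact h

theorem one_sub_norm_sub_one_sq_le_det (hS : S.PosSemidef) (htr : S.trace = Fintype.card n) :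
    1 - ‖S - 1‖ ^ 2 ≤ S.det := by
  have hsum : ∑ i, (hS.isHermitian.eigenvalues i - 1) = 0 := by
    rw [Finset.sum_sub_distrib, sub_eq_zero]
    simpa [htr] using hS.isHermitian.trace_eq_sum_eigenvalues.symm
  have h := one_sub_sum_sq_le_prod_one_add Finset.univ
    (fun i _ => by linarith [hS.eigenvalues_nonneg i]) hsum
  simpa [frobenius_norm_sub_one_sq_eq_sum_eigenvalues hS.isHermitian,
    hS.isHermitian.det_eq_prod_eigenvalues] using h

end DeterminantTrace

section SquareRoot

variable {n : Type*} [Fintype n]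

theorem ofLp_dotProduct_self (x : EuclideanSpace ℝ n) : x.ofLp ⬝ᵥ x.ofLp = ‖x‖ ^ 2 := by
  rw [EuclideanSpace.real_norm_sq_eq]
  simp only [dotProduct, sq]

variable [DecidableEq n] {X : Matrix n n ℝ}

theorem transpose_sqrt (X : Matrix n n ℝ) : (CFC.sqrt X)ᵀ = CFC.sqrt X := by
  rw [← conjTranspose_eq_transpose_of_trivial]
  exact (CFC.sqrt_nonneg X).posSemidef.isHermitian

theorem sqrt_mul_sqrt (hX : X.PosSemidef) : CFC.sqrt X * CFC.sqrt X = X :=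
  CFC.sqrt_mul_sqrt_self X hX.nonneg

theorem det_sqrt (hX : X.PosSemidef) : (CFC.sqrt X).det = √X.det := by
  rw [eq_comm, Real.sqrt_eq_iff_mul_self_eq hX.det_nonneg
    (CFC.sqrt_nonneg X).posSemidef.det_nonneg, ← det_mul, sqrt_mul_sqrt hX]

theorem posDef_sqrt (hX : X.PosDef) : (CFC.sqrt X).PosDef := by
  rw [(CFC.sqrt_nonneg X).posSemidef.posDef_iff_isUnit, isUnit_iff_isUnit_det,
    det_sqrt hX.posSemidef]
  exact (Real.sqrt_pos.2 hX.det_pos).ne'.isUnit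

theorem norm_toEuclideanLin_sqrt_sq (hX : X.PosSemidef) (x : EuclideanSpace ℝ n) :
    ‖toEuclideanLin (CFC.sqrt X) x‖ ^ 2 = x.ofLp ⬝ᵥ X *ᵥ x.ofLp := by
  conv_rhs => rw [← sqrt_mul_sqrt hX, ← mulVec_mulVec, dotProduct_mulVec, ← mulVec_transpose,
    transpose_sqrt]
  rw [← ofLp_dotProduct_self, toLpLin_apply]

end SquareRoot

section DeterminantDuality

variable {n : Type*} [Fintype n] [DecidableEq n] {X S : Matrix n n ℝ}

theorem posSemidef_sqrt_mul_mul_sqrt (X : Matrix n n ℝ) (hS : S.PosSemidef) :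
    (CFC.sqrt X * S * CFC.sqrt X).PosSemidef := by
  simpa only [conjTranspose_eq_transpose_of_trivial, transpose_sqrt] using
    hS.mul_mul_conjTranspose_same (CFC.sqrt X)

theorem trace_sqrt_mul_mul_sqrt (hX : X.PosSemidef) (S : Matrix n n ℝ) :
    (CFC.sqrt X * S * CFC.sqrt X).trace = (X * S).trace := by
  rw [trace_mul_comm, ← mul_assoc, sqrt_mul_sqrt hX]

theorem det_sqrt_mul_mul_sqrt (hX : X.PosSemidef) (S : Matrix n n ℝ) :
    (CFC.sqrt X * S * CFC.sqrt X).det = X.det * S.det := by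
  rw [det_mul, det_mul, mul_right_comm, ← det_mul, sqrt_mul_sqrt hX]

theorem det_mul_det_le_one_of_trace_mul_le (hX : X.PosSemidef) (hS : S.PosSemidef)
    (htr : (X * S).trace ≤ Fintype.card n) : X.det * S.det ≤ 1 := by
  rw [← trace_sqrt_mul_mul_sqrt hX] at htr
  rw [← det_sqrt_mul_mul_sqrt hX]
  exact det_le_one_of_trace_le (posSemidef_sqrt_mul_mul_sqrt X hS) htr

theorem inv_eq_of_one_le_det_mul_det (hX : X.PosSemidef) (hS : S.PosSemidef)
    (htr : (X * S).trace ≤ Fintype.card n) (hdet : 1 ≤ X.det * S.det) : X⁻¹ = S := by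
  rw [← trace_sqrt_mul_mul_sqrt hX] at htr
  rw [← det_sqrt_mul_mul_sqrt hX] at hdet
  have h := eq_one_of_one_le_det_of_trace_le (posSemidef_sqrt_mul_mul_sqrt X hS) hdet htr
  rw [mul_assoc, mul_eq_one_comm, mul_assoc, sqrt_mul_sqrt hX] at h
  exact inv_eq_left_inv h

end DeterminantDuality

section FrameOperator

variable {ι n : Type*} [Fintype ι]

/-- The frame operator `∑ wᵢ φᵢ φᵢᵀ` of `Φ` with weights `w`, as a matrix. The weights play the role
of squared scalars, so `Φ` is scalable iff some nonnegative `w` makes it the identity. -/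
def frameOperator (w : ι → ℝ) (Φ : ι → EuclideanSpace ℝ n) : Matrix n n ℝ :=
  ∑ i, w i • vecMulVec (Φ i).ofLp (Φ i).ofLp

theorem frameOperator_add_weights (w w' : ι → ℝ) (Φ : ι → EuclideanSpace ℝ n) :
    frameOperator (w + w') Φ = frameOperator w Φ + frameOperator w' Φ := by
  simp only [frameOperator, Pi.add_apply, add_smul, Finset.sum_add_distrib]

theorem frameOperator_smul_weights (c : ℝ) (w : ι → ℝ) (Φ : ι → EuclideanSpace ℝ n) :
    frameOperator (c • w) Φ = c • frameOperator w Φ := by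
  simp only [frameOperator, Pi.smul_apply, smul_assoc, Finset.smul_sum]

theorem frameOperator_single_weight [DecidableEq ι] (i : ι) (Φ : ι → EuclideanSpace ℝ n) :
    frameOperator (Pi.single i 1) Φ = vecMulVec (Φ i).ofLp (Φ i).ofLp := by
  rw [frameOperator, Finset.sum_eq_single i] <;> simp +contextual

theorem frameOperator_smul_vectors (w : ι → ℝ) (s : ι → ℝ) (Φ : ι → EuclideanSpace ℝ n) :
    frameOperator w (fun i => s i • Φ i) = frameOperator (fun i => w i * s i ^ 2) Φ := by
  simp [frameOperator, smul_vecMulVec, vecMulVec_smul, smul_smul, sq]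

theorem isSymm_frameOperator (w : ι → ℝ) (Φ : ι → EuclideanSpace ℝ n) :
    (frameOperator w Φ).IsSymm := by
  simp [IsSymm, frameOperator, transpose_sum, transpose_smul, transpose_vecMulVec]

theorem posSemidef_frameOperator [Finite n] {w : ι → ℝ} (hw : ∀ i, 0 ≤ w i)
    (Φ : ι → EuclideanSpace ℝ n) : (frameOperator w Φ).PosSemidef :=
  posSemidef_sum _ fun i _ => (posSemidef_vecMulVec_self_star (Φ i).ofLp).smul (hw i)

variable [Fintype n]

theorem trace_mul_frameOperator (X : Matrix n n ℝ) (w : ι → ℝ) (Φ : ι → EuclideanSpace ℝ n) :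
    (X * frameOperator w Φ).trace = ∑ i, w i * ((Φ i).ofLp ⬝ᵥ X *ᵥ (Φ i).ofLp) := by
  simp only [frameOperator, Finset.mul_sum, trace_sum, mul_smul_comm, trace_smul, smul_eq_mul,
    mul_vecMulVec, trace_vecMulVec, dotProduct_comm]

theorem trace_frameOperator (w : ι → ℝ) (Φ : ι → EuclideanSpace ℝ n) :
    (frameOperator w Φ).trace = ∑ i, w i * ‖Φ i‖ ^ 2 := by
  simp only [frameOperator, trace_sum, trace_smul, smul_eq_mul, trace_vecMulVec,
    ofLp_dotProduct_self]

theorem dotProduct_frameOperator_mulVec (w : ι → ℝ) (Φ : ι → EuclideanSpace ℝ n)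
    (x : EuclideanSpace ℝ n) :
    x.ofLp ⬝ᵥ frameOperator w Φ *ᵥ x.ofLp = ∑ i, w i * |inner ℝ x (Φ i)| ^ 2 := by
  simp only [frameOperator, sum_mulVec, dotProduct_sum, smul_mulVec, dotProduct_smul,
    vecMulVec_mulVec, smul_eq_mul, sq_abs, EuclideanSpace.inner_eq_star_dotProduct, star_trivial,
    op_smul_eq_smul]
  exact Finset.sum_congr rfl fun i _ => by rw [dotProduct_comm x.ofLp, sq]

theorem frameOperator_toEuclideanLin [DecidableEq n] (A : Matrix n n ℝ) (w : ι → ℝ)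
    (Φ : ι → EuclideanSpace ℝ n) :
    frameOperator w (fun i => toEuclideanLin A (Φ i)) = A * frameOperator w Φ * Aᵀ := by
  simp [frameOperator, toLpLin_apply, Finset.mul_sum, Finset.sum_mul, mul_vecMulVec,
    vecMulVec_mul, vecMul_transpose]

end FrameOperator

section OptimalDesign

variable {ι n : Type*} [Fintype n]

/-- All vectors of `Φ` lie in `E(X)`. Stated without the convex hull and the reflected vectors, this
is the constraint `φᵀ X φ ≤ 1` of the determinant maximization behind the minimal ellipsoid. -/
def Encloses (X : Matrix n n ℝ) (Φ : ι → EuclideanSpace ℝ n) : Prop :=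
  ∀ i, (Φ i).ofLp ⬝ᵥ X *ᵥ (Φ i).ofLp ≤ 1

variable [Fintype ι] {Φ : ι → EuclideanSpace ℝ n} {X : Matrix n n ℝ} {w : ι → ℝ}

theorem trace_mul_frameOperator_le (hX : Encloses X Φ) (hw : ∀ i, 0 ≤ w i) :
    (X * frameOperator w Φ).trace ≤ ∑ i, w i := by
  rw [trace_mul_frameOperator]
  exact Finset.sum_le_sum fun i _ => mul_le_of_le_one_right (hw i) (hX i)

variable [DecidableEq n]

theorem det_add_smul_vecMulVec {S : Matrix n n ℝ} (hS : IsUnit S.det) (s : ℝ) (v : n → ℝ) :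
    (S + s • vecMulVec v v).det = S.det * (1 + s * (v ⬝ᵥ S⁻¹ *ᵥ v)) := by
  rw [← smul_vecMulVec, vecMulVec_eq Unit, det_add_replicateCol_mul_replicateRow hS,
    Matrix.mul_assoc, ← replicateCol_mulVec, det_unique (n := Unit), Matrix.add_apply, one_apply_eq,
    replicateRow_mul_replicateCol_apply, mulVec_smul, dotProduct_smul, smul_eq_mul]

theorem dotProduct_inv_mulVec_le_of_isMaxOn (hw : w ∈ stdSimplex ℝ ι)
    (hmax : IsMaxOn (fun w => (frameOperator w Φ).det) (stdSimplex ℝ ι) w)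
    (hpos : (frameOperator w Φ).PosDef) (i : ι) :
    (Φ i).ofLp ⬝ᵥ (frameOperator w Φ)⁻¹ *ᵥ (Φ i).ofLp ≤ Fintype.card n := by
  classical
  refine le_of_forall_one_add_mul_le_one_add_pow fun s hs => ?_
  have : 0 < 1 + s := by positivity
  have hmem : (1 + s)⁻¹ • (w + s • Pi.single i 1) ∈ stdSimplex ℝ ι := by
    rw [smul_add, smul_smul]
    exact convex_stdSimplex ℝ ι hw (single_mem_stdSimplex ℝ i) (by positivity) (by positivity)
      (by field_simp)
  have h : (frameOperator ((1 + s)⁻¹ • (w + s • Pi.single i 1)) Φ).det ≤ _ := hmax hmem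
  rw [frameOperator_smul_weights, frameOperator_add_weights, frameOperator_smul_weights,
    frameOperator_single_weight, det_smul, det_add_smul_vecMulVec hpos.det_pos.ne'.isUnit,
    inv_pow, inv_mul_le_iff₀ (by positivity), mul_comm, mul_le_mul_iff_left₀ hpos.det_pos] at h
  exact h

theorem exists_isMaxOn_det_frameOperator [Nonempty ι] (Φ : ι → EuclideanSpace ℝ n) :
    ∃ w ∈ stdSimplex ℝ ι, IsMaxOn (fun w => (frameOperator w Φ).det) (stdSimplex ℝ ι) w := by
  classical
  refine (isCompact_stdSimplex ℝ ι).exists_isMaxOn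
    ⟨_, single_mem_stdSimplex ℝ (Classical.arbitrary ι)⟩ (Continuous.continuousOn ?_)
  unfold frameOperator
  fun_prop

theorem exists_encloses_inv_eq_frameOperator [Nonempty n]
    (hΦ : (frameOperator 1 Φ).PosDef) :
    ∃ X : Matrix n n ℝ, X.PosDef ∧ Encloses X Φ ∧
      ∃ w : ι → ℝ, (∀ i, 0 ≤ w i) ∧ ∑ i, w i = Fintype.card n ∧ X⁻¹ = frameOperator w Φ := by
  have : Nonempty ι := by
    by_contra h
    rw [not_nonempty_iff] at h
    simpa [frameOperator] using hΦ.det_pos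
  have hι : (0 : ℝ) < Fintype.card ι := Nat.cast_pos.2 Fintype.card_pos
  have hn : (0 : ℝ) < Fintype.card n := Nat.cast_pos.2 Fintype.card_pos
  obtain ⟨w, hw, hmax⟩ := exists_isMaxOn_det_frameOperator Φ
  have hdet : 0 < (frameOperator w Φ).det := by
    have hunif : ((Fintype.card ι : ℝ)⁻¹ • (1 : ι → ℝ)) ∈ stdSimplex ℝ ι :=
      ⟨fun i => by simp, by simp [hι.ne']⟩
    refine lt_of_lt_of_le ?_ (hmax hunif)
    simp only [frameOperator_smul_weights]
    exact (hΦ.smul (inv_pos.2 hι)).det_pos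
  have hpos : (frameOperator w Φ).PosDef :=
    (posSemidef_frameOperator hw.1 Φ).posDef_iff_isUnit.2
      ((isUnit_iff_isUnit_det _).2 hdet.ne'.isUnit)
  refine ⟨(Fintype.card n : ℝ)⁻¹ • (frameOperator w Φ)⁻¹, hpos.inv.smul (inv_pos.2 hn),
    fun i => ?_, (Fintype.card n : ℝ) • w, fun i => mul_nonneg hn.le (hw.1 i), ?_, ?_⟩
  · rw [smul_mulVec, dotProduct_smul, smul_eq_mul, inv_mul_le_one₀ hn]
    exact dotProduct_inv_mulVec_le_of_isMaxOn hw hmax hpos i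
  · simp [← Finset.mul_sum, hw.2]
  · refine inv_eq_left_inv ?_
    rw [frameOperator_smul_weights, smul_mul_smul_comm, mul_inv_cancel₀ hn.ne', one_smul,
      mul_nonsing_inv _ hdet.ne'.isUnit]

theorem det_mul_det_frameOperator_le_one (hX : X.PosSemidef) (hXΦ : Encloses X Φ)
    (hw : ∀ i, 0 ≤ w i) (hsum : ∑ i, w i = Fintype.card n) :
    X.det * (frameOperator w Φ).det ≤ 1 :=
  det_mul_det_le_one_of_trace_mul_le hX (posSemidef_frameOperator hw Φ)
    ((trace_mul_frameOperator_le hXΦ hw).trans_eq hsum)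

end OptimalDesign

section Sparsification

variable {ι n : Type*} [Fintype ι] [Fintype n]

theorem affineIndependent_vecMulVec_card_le {v : ι → EuclideanSpace ℝ n} (hv : ∀ i, ‖v i‖ = 1)
    (h : AffineIndependent ℝ fun i => vecMulVec (v i).ofLp (v i).ofLp) :
    Fintype.card ι ≤ Fintype.card n * (Fintype.card n + 1) / 2 := by
  classical
  -- A symmetric matrix is a function on unordered pairs of indices.
  let y : ι → Sym2 n → ℝ := fun i =>
    Sym2.lift ⟨fun a b => v i a * v i b, fun a b => mul_comm _ _⟩
  have hy : LinearIndependent ℝ y := by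
    rw [Fintype.linearIndependent_iff]
    intro g hg
    have hzero : frameOperator g v = 0 := by
      ext a b
      simpa [y, frameOperator, Matrix.sum_apply, vecMulVec_apply] using congrFun hg s(a, b)
    have hsum : ∑ i, g i = 0 := by
      simpa [trace_frameOperator, hv] using congrArg trace hzero
    exact fun i => h.eq_zero_of_sum_eq_zero hsum hzero i (Finset.mem_univ i)
  calc Fintype.card ι ≤ Module.finrank ℝ (Sym2 n → ℝ) := hy.fintype_card_le_finrank
    _ = Fintype.card n * (Fintype.card n + 1) / 2 := by
      rw [Module.finrank_fintype_fun_eq_card, Sym2.card, Nat.choose_two_right,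
        Nat.add_sub_cancel, mul_comm]

theorem exists_frameOperator_eq_card_le {Φ : ι → EuclideanSpace ℝ n} (hΦ : ∀ i, ‖Φ i‖ = 1)
    {w : ι → ℝ} (hw : w ∈ stdSimplex ℝ ι) :
    ∃ ρ : ι → ℝ, (∀ i, 0 ≤ ρ i) ∧ frameOperator ρ Φ = frameOperator w Φ ∧
      (Finset.univ.filter fun i => 0 < ρ i).card ≤
        Fintype.card n * (Fintype.card n + 1) / 2 := by
  classical
  have hmem : frameOperator w Φ ∈
      convexHull ℝ (Set.range fun i => vecMulVec (Φ i).ofLp (Φ i).ofLp) :=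
    (convex_convexHull ℝ _).sum_mem (fun i _ => hw.1 i) hw.2
      fun i _ => subset_convexHull ℝ _ ⟨i, rfl⟩
  obtain ⟨κ, _, z, u, hz, hindep, hu, -, hsum⟩ := eq_pos_convex_span_of_mem_convexHull hmem
  choose f hf using fun k => hz ⟨k, rfl⟩
  obtain rfl : (fun k => vecMulVec (Φ (f k)).ofLp (Φ (f k)).ofLp) = z := funext hf
  have hinj : Function.Injective f := fun a b hab => hindep.injective (by simp only [hab])
  let ρ : ι → ℝ := Function.extend f u (0 : ι → ℝ)
  have hρf : ∀ k, ρ (f k) = u k := hinj.extend_apply u (0 : ι → ℝ)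
  have hρ₀ : ∀ i, i ∉ Set.range f → ρ i = 0 :=
    Function.extend_apply' u (0 : ι → ℝ)
  refine ⟨ρ, fun i => ?_, ?_, ?_⟩
  · by_cases hi : i ∈ Set.range f
    · obtain ⟨k, rfl⟩ := hi
      exact (hρf k).symm ▸ (hu k).le
    · exact (hρ₀ i hi).ge
  · rw [← hsum]
    exact (Fintype.sum_of_injective f hinj _ _ (fun i hi => by rw [hρ₀ i hi, zero_smul])
      fun k => by rw [hρf]).symm
  · have hsub : (Finset.univ.filter fun i => 0 < ρ i) ⊆ Finset.univ.image f := fun i hi => by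
      by_contra hnot
      exact (Finset.mem_filter.1 hi).2.ne' (hρ₀ i (by simpa using hnot))
    exact (Finset.card_le_card hsub).trans (Finset.card_image_le.trans
      (affineIndependent_vecMulVec_card_le (fun k => hΦ (f k)) hindep))

end Sparsification

section Ellipsoids

variable {M N : ℕ} {Φ : Fin M → EuclideanSpace ℝ (Fin N)} {X Y : Matrix (Fin N) (Fin N) ℝ}

theorem mem_ellipsoid {v c : EuclideanSpace ℝ (Fin N)} :
    v ∈ ellipsoid X c ↔ (v - c).ofLp ⬝ᵥ X *ᵥ (v - c).ofLp ≤ 1 := by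
  change inner ℝ (toEuclideanLin X (v - c)) (v - c) ≤ 1 ↔ _
  rw [EuclideanSpace.inner_eq_star_dotProduct, star_trivial, toLpLin_apply]

theorem ellipsoid_eq_preimage_closedBall (hX : X.PosSemidef) (c : EuclideanSpace ℝ (Fin N)) :
    ellipsoid X c =
      (· + -c) ⁻¹' (toEuclideanLin (CFC.sqrt X) ⁻¹' Metric.closedBall 0 1) := by
  ext v
  rw [mem_ellipsoid, ← norm_toEuclideanLin_sqrt_sq hX, sq_le_one_iff₀ (norm_nonneg _),
    Set.mem_preimage, Set.mem_preimage, mem_closedBall_zero_iff, sub_eq_add_neg]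

theorem convex_ellipsoid_zero (hX : X.PosSemidef) : Convex ℝ (ellipsoid X 0) := by
  simpa [ellipsoid_eq_preimage_closedBall hX] using (convex_closedBall _ _).linear_preimage _

theorem det_toEuclideanLin (X : Matrix (Fin N) (Fin N) ℝ) :
    LinearMap.det (toEuclideanLin X) = X.det := by
  rw [toEuclideanLin_eq_toLin_orthonormal, LinearMap.det_toLin]

theorem volume_ellipsoid (hX : X.PosDef) (c : EuclideanSpace ℝ (Fin N)) :
    MeasureTheory.volume (ellipsoid X c) = ENNReal.ofReal (√X.det)⁻¹ *
      MeasureTheory.volume (Metric.closedBall (0 : EuclideanSpace ℝ (Fin N)) 1) := by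
  have hdet : LinearMap.det (toEuclideanLin (CFC.sqrt X)) = √X.det := by
    rw [det_toEuclideanLin, det_sqrt hX.posSemidef]
  have hpos : 0 < √X.det := Real.sqrt_pos.2 hX.det_pos
  rw [ellipsoid_eq_preimage_closedBall hX.posSemidef, MeasureTheory.measure_preimage_add_right,
    MeasureTheory.Measure.addHaar_preimage_linearMap _ (hdet ▸ hpos.ne'), hdet,
    abs_of_pos (inv_pos.2 hpos)]

theorem normalizedVolume_ellipsoid (hX : X.PosDef) (c : EuclideanSpace ℝ (Fin N)) :
    normalizedVolume (ellipsoid X c) = (√X.det)⁻¹ := by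
  have hball := Metric.measure_closedBall_pos MeasureTheory.volume
    (0 : EuclideanSpace ℝ (Fin N)) one_pos
  rw [normalizedVolume, volume_ellipsoid hX, ENNReal.toReal_mul,
    ENNReal.toReal_ofReal (by positivity), mul_div_cancel_right₀]
  exact (ENNReal.toReal_pos hball.ne' MeasureTheory.measure_closedBall_lt_top.ne).ne'

theorem volume_ellipsoid_le_iff (hX : X.PosDef) (hY : Y.PosDef)
    (c e : EuclideanSpace ℝ (Fin N)) :
    MeasureTheory.volume (ellipsoid X c) ≤ MeasureTheory.volume (ellipsoid Y e) ↔
      Y.det ≤ X.det := by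
  rw [volume_ellipsoid hX, volume_ellipsoid hY,
    ENNReal.mul_le_mul_iff_left (Metric.measure_closedBall_pos _ _ one_pos).ne'
      MeasureTheory.measure_closedBall_lt_top.ne,
    ENNReal.ofReal_le_ofReal_iff (by positivity),
    inv_le_inv₀ (Real.sqrt_pos.2 hX.det_pos) (Real.sqrt_pos.2 hY.det_pos),
    Real.sqrt_le_sqrt_iff hX.det_pos.le]

theorem Encloses.convexHull_subset_ellipsoid (h : Encloses X Φ) (hX : X.PosSemidef) :
    convexHull ℝ (symmetrized Φ) ⊆ ellipsoid X 0 := by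
  refine convexHull_min ?_ (convex_ellipsoid_zero hX)
  rintro _ (⟨i, rfl⟩ | ⟨i, rfl⟩)
  · simpa [mem_ellipsoid] using h i
  · simpa [mem_ellipsoid, mulVec_neg] using h i

theorem encloses_of_convexHull_subset_ellipsoid (hX : X.PosSemidef)
    {c : EuclideanSpace ℝ (Fin N)} (h : convexHull ℝ (symmetrized Φ) ⊆ ellipsoid X c) :
    Encloses X Φ := by
  intro i
  -- Averaging the conditions at `φ` and `-φ` leaves `⟨Xφ, φ⟩ + ⟨Xc, c⟩ ≤ 1`.
  have hpos := h (subset_convexHull ℝ _ (Or.inl ⟨i, rfl⟩))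
  have hneg := h (subset_convexHull ℝ _ (Or.inr ⟨i, rfl⟩))
  have hc := hX.dotProduct_mulVec_nonneg c.ofLp
  simp only [mem_ellipsoid, WithLp.ofLp_sub, WithLp.ofLp_neg, mulVec_sub, mulVec_neg,
    dotProduct_sub, sub_dotProduct, neg_dotProduct, dotProduct_neg, star_trivial] at hpos hneg hc
  linarith

theorem isMinimalEllipsoidOf_ellipsoid_iff (hX : X.PosDef) :
    IsMinimalEllipsoidOf Φ (ellipsoid X 0) ↔
      Encloses X Φ ∧ ∀ Y : Matrix (Fin N) (Fin N) ℝ, Y.PosDef → Encloses Y Φ →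
        Y.det ≤ X.det := by
  constructor
  · intro h
    refine ⟨encloses_of_convexHull_subset_ellipsoid hX.posSemidef h.subset, fun Y hY hΦ => ?_⟩
    rw [← volume_ellipsoid_le_iff hX hY 0 0]
    exact h.volume_le Y 0 hY (hΦ.convexHull_subset_ellipsoid hY.posSemidef)
  · rintro ⟨h, hmax⟩
    refine ⟨⟨X, 0, hX, rfl⟩, h.convexHull_subset_ellipsoid hX.posSemidef, fun Y c hY hΦ => ?_⟩
    rw [volume_ellipsoid_le_iff hX hY]
    exact hmax Y hY (encloses_of_convexHull_subset_ellipsoid hY.posSemidef hΦ)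

end Ellipsoids

section MinimalEllipsoid

variable {M N : ℕ} {Φ : Fin M → EuclideanSpace ℝ (Fin N)} {X Y : Matrix (Fin N) (Fin N) ℝ}

theorem posDef_frameOperator_of_isFrame (hΦ : IsFrame Φ) : (frameOperator 1 Φ).PosDef := by
  obtain ⟨A, B, hA, -, hAB⟩ := hΦ
  refine PosDef.of_dotProduct_mulVec_pos
    (posSemidef_frameOperator (fun _ => zero_le_one) Φ).isHermitian fun x hx => ?_
  have hx' : WithLp.toLp 2 x ≠ 0 := by simpa using hx
  calc 0 < A * ‖WithLp.toLp 2 x‖ ^ 2 := by positivity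
    _ ≤ ∑ i, |inner ℝ (WithLp.toLp 2 x) (Φ i)| ^ 2 := (hAB _).1
    _ = star x ⬝ᵥ frameOperator 1 Φ *ᵥ x := by
      rw [star_trivial]
      simpa using (dotProduct_frameOperator_mulVec 1 Φ (WithLp.toLp 2 x)).symm

theorem exists_isMinimalEllipsoidOf (hN : 1 ≤ N) (hΦ : IsFrame Φ) :
    ∃ X : Matrix (Fin N) (Fin N) ℝ, X.PosDef ∧ IsMinimalEllipsoidOf Φ (ellipsoid X 0) := by
  have : NeZero N := ⟨by omega⟩
  obtain ⟨X, hX, hXΦ, w, hw, hsum, hinv⟩ :=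
    exists_encloses_inv_eq_frameOperator (posDef_frameOperator_of_isFrame hΦ)
  refine ⟨X, hX, (isMinimalEllipsoidOf_ellipsoid_iff hX).2 ⟨hXΦ, fun Y hY hYΦ => ?_⟩⟩
  have h := det_mul_det_frameOperator_le_one hY.posSemidef hYΦ hw hsum
  rwa [← hinv, det_nonsing_inv, Ring.inverse_eq_inv', ← div_eq_mul_inv,
    div_le_one hX.det_pos] at h

theorem exists_inv_eq_frameOperator_of_isMinimalEllipsoidOf (hN : 1 ≤ N) (hΦ : IsFrame Φ)
    (hX : X.PosDef) (hmin : IsMinimalEllipsoidOf Φ (ellipsoid X 0)) :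
    ∃ w : Fin M → ℝ, (∀ i, 0 ≤ w i) ∧ ∑ i, w i = N ∧ X⁻¹ = frameOperator w Φ := by
  have : NeZero N := ⟨by omega⟩
  obtain ⟨hXΦ, hmax⟩ := (isMinimalEllipsoidOf_ellipsoid_iff hX).1 hmin
  obtain ⟨Y, hY, hYΦ, w, hw, hsum, hinv⟩ :=
    exists_encloses_inv_eq_frameOperator (posDef_frameOperator_of_isFrame hΦ)
  refine ⟨w, hw, by simpa using hsum, inv_eq_of_one_le_det_mul_det hX.posSemidef
    (posSemidef_frameOperator hw Φ) ((trace_mul_frameOperator_le hXΦ hw).trans_eq hsum) ?_⟩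
  rw [← hinv, det_nonsing_inv, Ring.inverse_eq_inv', ← div_eq_mul_inv, one_le_div hY.det_pos]
  exact hmax Y hY hYΦ

theorem trace_inv_of_isMinimalEllipsoidOf (hN : 1 ≤ N) (hΦ : IsUnitNormFrame Φ)
    (hX : X.PosDef) (hmin : IsMinimalEllipsoidOf Φ (ellipsoid X 0)) : X⁻¹.trace = N := by
  obtain ⟨w, -, hsum, hinv⟩ :=
    exists_inv_eq_frameOperator_of_isMinimalEllipsoidOf hN hΦ.1 hX hmin
  simpa [hinv, trace_frameOperator, hΦ.2] using hsum

theorem exists_isWeight (hN : 1 ≤ N) (hΦ : IsUnitNormFrame Φ) (hX : X.PosDef)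
    (hmin : IsMinimalEllipsoidOf Φ (ellipsoid X 0)) : ∃ ρ : Fin M → ℝ, IsWeight Φ X ρ := by
  have hN₀ : (0 : ℝ) < N := by exact_mod_cast hN
  obtain ⟨w, hw, hsum, hinv⟩ :=
    exists_inv_eq_frameOperator_of_isMinimalEllipsoidOf hN hΦ.1 hX hmin
  have hsimplex : (N : ℝ)⁻¹ • w ∈ stdSimplex ℝ (Fin M) :=
    ⟨fun i => mul_nonneg (inv_nonneg.2 hN₀.le) (hw i),
      by simp [← Finset.mul_sum, hsum, hN₀.ne']⟩
  obtain ⟨ρ, hρ, hop, hcard⟩ := exists_frameOperator_eq_card_le hΦ.2 hsimplex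
  refine ⟨(N : ℝ) • ρ, fun i => mul_nonneg hN₀.le (hρ i), le_min ?_ ?_, ?_⟩
  · simpa using Finset.card_filter_le Finset.univ fun i => 0 < ((N : ℝ) • ρ) i
  · simpa [hN₀] using hcard
  · change X⁻¹ = frameOperator ((N : ℝ) • ρ) Φ
    rw [frameOperator_smul_weights, hop, frameOperator_smul_weights, smul_smul,
      mul_inv_cancel₀ hN₀.ne', one_smul, hinv]

theorem IsWeight.inv_eq_frameOperator {ρ : Fin M → ℝ} (hρ : IsWeight Φ X ρ) :
    X⁻¹ = frameOperator ρ Φ := hρ.inv_eq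

theorem dotProduct_mulVec_eq_one_of_isWeight (hΦ : ∀ i, ‖Φ i‖ = 1) (hX : X.PosDef)
    (hXΦ : Encloses X Φ) (htr : X⁻¹.trace = N) {ρ : Fin M → ℝ} (hρ : IsWeight Φ X ρ)
    {i : Fin M} (hi : 0 < ρ i) : (Φ i).ofLp ⬝ᵥ X *ᵥ (Φ i).ofLp = 1 := by
  have hsum : ∑ j, ρ j = N := by
    simpa [hρ.inv_eq_frameOperator, trace_frameOperator, hΦ] using htr
  have hsum' : ∑ j, ρ j * ((Φ j).ofLp ⬝ᵥ X *ᵥ (Φ j).ofLp) = N := by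
    rw [← trace_mul_frameOperator, ← hρ.inv_eq_frameOperator,
      mul_nonsing_inv _ hX.det_pos.ne'.isUnit, trace_one, Fintype.card_fin]
  have hle : ∀ j ∈ Finset.univ, ρ j * ((Φ j).ofLp ⬝ᵥ X *ᵥ (Φ j).ofLp) ≤ ρ j := fun j _ =>
    mul_le_of_le_one_right (hρ.nonneg j) (hXΦ j)
  have heq := (Finset.sum_eq_sum_iff_of_le hle).1 (hsum'.trans hsum.symm) i (Finset.mem_univ i)
  exact (mul_eq_left₀ hi.ne').1 heq

end MinimalEllipsoid

section Scalable

variable {M N : ℕ} {Φ Ψ : Fin M → EuclideanSpace ℝ (Fin N)} {X : Matrix (Fin N) (Fin N) ℝ}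

theorem eq_of_forall_dotProduct_mulVec_eq {n : Type*} [Fintype n]
    {S T : Matrix n n ℝ} (hS : S.IsSymm) (hT : T.IsSymm)
    (h : ∀ x, x ⬝ᵥ S *ᵥ x = x ⬝ᵥ T *ᵥ x) : S = T := by
  have hpolar : ∀ {R : Matrix n n ℝ}, R.IsSymm → ∀ x y,
      (x + y) ⬝ᵥ R *ᵥ (x + y) = x ⬝ᵥ R *ᵥ x + 2 * (x ⬝ᵥ R *ᵥ y) + y ⬝ᵥ R *ᵥ y := by
    intro R hR x y
    have hcomm : y ⬝ᵥ R *ᵥ x = x ⬝ᵥ R *ᵥ y := by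
      rw [dotProduct_mulVec, ← mulVec_transpose, hR.eq, dotProduct_comm]
    rw [mulVec_add, add_dotProduct, dotProduct_add, dotProduct_add, hcomm]
    ring
  classical
  ext i j
  have hij := h (Pi.single i 1 + Pi.single j 1)
  rw [hpolar hS, hpolar hT, h, h] at hij
  simpa using hij

theorem isTightFrame_iff :
    IsTightFrame Ψ ↔ ∃ A : ℝ, 0 < A ∧ frameOperator 1 Ψ = A • 1 := by
  refine exists_congr fun A => and_congr_right fun _ => ⟨fun h => ?_, fun h x => ?_⟩
  · refine eq_of_forall_dotProduct_mulVec_eq (isSymm_frameOperator _ _) (isSymm_one.smul A)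
      fun x => ?_
    have hx := dotProduct_frameOperator_mulVec 1 Ψ (WithLp.toLp 2 x)
    simp only [Pi.one_apply, one_mul, h, ← ofLp_dotProduct_self] at hx
    rw [hx, smul_mulVec, one_mulVec, dotProduct_smul, smul_eq_mul]
  · have hx := dotProduct_frameOperator_mulVec 1 Ψ x
    rw [h, smul_mulVec, one_mulVec, dotProduct_smul, smul_eq_mul, ofLp_dotProduct_self] at hx
    simpa using hx.symm

theorem isFrame_of_frameOperator_eq_one {c : Fin M → ℝ} (hc : ∀ i, 0 ≤ c i)
    (h : frameOperator c Ψ = 1) : IsFrame Ψ := by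
  have hsum : 0 ≤ ∑ i, c i := Finset.sum_nonneg fun i _ => hc i
  refine ⟨(1 + ∑ i, c i)⁻¹, 1 + ∑ i, ‖Ψ i‖ ^ 2, by positivity, by positivity, fun x => ⟨?_, ?_⟩⟩
  · have hx := dotProduct_frameOperator_mulVec c Ψ x
    rw [h, one_mulVec, ofLp_dotProduct_self] at hx
    rw [inv_mul_le_iff₀ (by positivity), hx, Finset.mul_sum]
    refine Finset.sum_le_sum fun i _ => mul_le_mul_of_nonneg_right ?_ (sq_nonneg _)
    linarith [Finset.single_le_sum (fun j _ => hc j) (Finset.mem_univ i)]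
  · rw [add_mul, one_mul, Finset.sum_mul]
    refine le_add_of_nonneg_of_le (sq_nonneg _) (Finset.sum_le_sum fun i _ => ?_)
    rw [← mul_pow, mul_comm]
    gcongr
    exact abs_real_inner_le_norm _ _

theorem isScalable_iff :
    IsScalable Ψ ↔ ∃ c : Fin M → ℝ, (∀ i, 0 ≤ c i) ∧ frameOperator c Ψ = 1 := by
  constructor
  · rintro ⟨-, s, -, hs⟩
    obtain ⟨A, hA, h⟩ := isTightFrame_iff.1 hs
    refine ⟨A⁻¹ • fun i => s i ^ 2, fun i => mul_nonneg (inv_pos.2 hA).le (sq_nonneg _), ?_⟩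
    rw [frameOperator_smul_vectors] at h
    simp only [Pi.one_apply, one_mul] at h
    rw [frameOperator_smul_weights, h, inv_smul_smul₀ hA.ne']
  · rintro ⟨c, hc, h⟩
    refine ⟨isFrame_of_frameOperator_eq_one hc h, fun i => √(c i), fun i => Real.sqrt_nonneg _,
      isTightFrame_iff.2 ⟨1, one_pos, ?_⟩⟩
    rw [frameOperator_smul_vectors, one_smul, ← h]
    simp only [Pi.one_apply, one_mul, Real.sq_sqrt (hc _)]

theorem sum_mul_norm_sq_eq {c : Fin M → ℝ} (h : frameOperator c Ψ = 1) :
    ∑ i, c i * ‖Ψ i‖ ^ 2 = N := by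
  rw [← trace_frameOperator, h, trace_one, Fintype.card_fin]

theorem mul_norm_sq_le_one {c : Fin M → ℝ} (hc : ∀ i, 0 ≤ c i) (h : frameOperator c Ψ = 1)
    (i : Fin M) : c i * ‖Ψ i‖ ^ 2 ≤ 1 := by
  have hi : c i * (‖Ψ i‖ ^ 2) ^ 2 ≤ ‖Ψ i‖ ^ 2 := by
    have hx := dotProduct_frameOperator_mulVec c Ψ (Ψ i)
    rw [h, one_mulVec, ofLp_dotProduct_self] at hx
    conv_rhs => rw [hx]
    simpa using Finset.single_le_sum
      (fun j _ => mul_nonneg (hc j) (sq_nonneg |inner ℝ (Ψ i) (Ψ j)|)) (Finset.mem_univ i)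
  rcases (sq_nonneg ‖Ψ i‖).eq_or_lt with hzero | hpos
  · simp [← hzero]
  · exact le_of_mul_le_mul_right (by linarith) hpos

theorem IsScalable.le (h : IsScalable Ψ) : N ≤ M := by
  obtain ⟨c, hc, hΨ⟩ := isScalable_iff.1 h
  have hNM : (N : ℝ) ≤ M := by
    calc (N : ℝ) = ∑ i, c i * ‖Ψ i‖ ^ 2 := (sum_mul_norm_sq_eq hΨ).symm
      _ ≤ ∑ _i : Fin M, (1 : ℝ) := Finset.sum_le_sum fun i _ => mul_norm_sq_le_one hc hΨ i
      _ = M := by simp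
  exact_mod_cast hNM

theorem IsScalable.le_numK (hΨ : IsScalable Ψ) (hN : 1 ≤ N) : N ≤ numK M N := by
  refine le_min hΨ.le ?_
  rw [Nat.le_div_iff_mul_le two_pos]
  exact Nat.mul_le_mul_left N (by lia)

theorem isScalable_approxFrame (hX : X.PosDef) {ρ : Fin M → ℝ} (hρ : IsWeight Φ X ρ) :
    IsScalable (approxFrame Φ X ρ) := by
  set v := normalizedVolume (ellipsoid X 0) ^ (1 / (N : ℝ)) with hv
  have hv₀ : 0 < v := by
    rw [hv, normalizedVolume_ellipsoid hX]
    exact Real.rpow_pos_of_pos (inv_pos.2 (Real.sqrt_pos.2 hX.det_pos)) _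
  refine isScalable_iff.2 ⟨(v ^ 2)⁻¹ • ρ,
    fun i => mul_nonneg (by positivity) (hρ.nonneg i), ?_⟩
  calc frameOperator ((v ^ 2)⁻¹ • ρ) (approxFrame Φ X ρ)
      = (v ^ 2)⁻¹ • frameOperator ρ fun i => v • toEuclideanLin (CFC.sqrt X) (Φ i) := by
        rw [frameOperator_smul_weights]
        refine congrArg _ (Finset.sum_congr rfl fun i _ => ?_)
        rcases (hρ.nonneg i).eq_or_lt with hi | hi
        · rw [← hi, zero_smul, zero_smul]
        · rw [approxFrame, if_pos hi]
    _ = frameOperator ρ fun i => toEuclideanLin (CFC.sqrt X) (Φ i) := by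
        rw [frameOperator_smul_vectors, ← frameOperator_smul_weights]
        congr 1
        ext i
        simp [field]
    _ = CFC.sqrt X * X⁻¹ * CFC.sqrt X := by
        rw [frameOperator_toEuclideanLin, transpose_sqrt, hρ.inv_eq_frameOperator]
    _ = 1 := by
        rw [mul_eq_one_comm, ← mul_assoc, sqrt_mul_sqrt hX.posSemidef,
          mul_nonsing_inv _ hX.det_pos.ne'.isUnit]

end Scalable

section Distance

open scoped Matrix.Norms.Frobenius

variable {M N : ℕ} {Φ Ψ : Fin M → EuclideanSpace ℝ (Fin N)} {X : Matrix (Fin N) (Fin N) ℝ}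

theorem norm_smul_vecMulVec_sub_sq {n : Type*} [Fintype n] (a : ℝ) (φ ψ : EuclideanSpace ℝ n) :
    ‖a • vecMulVec φ.ofLp φ.ofLp - vecMulVec ψ.ofLp ψ.ofLp‖ ^ 2 =
      a ^ 2 * (‖φ‖ ^ 2) ^ 2 - 2 * a * inner ℝ φ ψ ^ 2 + (‖ψ‖ ^ 2) ^ 2 := by
  have hinner : inner ℝ φ ψ = φ.ofLp ⬝ᵥ ψ.ofLp := by
    rw [EuclideanSpace.inner_eq_star_dotProduct, star_trivial, dotProduct_comm]
  rw [frobenius_norm_sq_eq_trace, hinner, ← ofLp_dotProduct_self, ← ofLp_dotProduct_self]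
  simp only [transpose_sub, transpose_smul, transpose_vecMulVec, sub_mul, mul_sub, smul_mul_assoc,
    mul_smul_comm, vecMulVec_mul_vecMulVec, trace_sub, trace_smul, trace_vecMulVec,
    dotProduct_smul, smul_eq_mul, dotProduct_comm ψ.ofLp φ.ofLp]
  ring

theorem norm_smul_vecMulVec_sub_le {n : Type*} [Fintype n] {φ : EuclideanSpace ℝ n}
    (hφ : ‖φ‖ = 1) (ψ : EuclideanSpace ℝ n) :
    ‖‖ψ‖ ^ 2 • vecMulVec φ.ofLp φ.ofLp - vecMulVec ψ.ofLp ψ.ofLp‖ ≤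
      ‖ψ‖ ^ 2 * (√2 * ‖φ - ψ‖) := by
  refine le_of_sq_le_sq ?_ (by positivity)
  have hgap : (‖ψ‖ ^ 2 * (√2 * ‖φ - ψ‖)) ^ 2 -
      ‖‖ψ‖ ^ 2 • vecMulVec φ.ofLp φ.ofLp - vecMulVec ψ.ofLp ψ.ofLp‖ ^ 2 =
        2 * ‖ψ‖ ^ 2 * (‖ψ‖ ^ 2 - inner ℝ φ ψ) ^ 2 := by
    rw [norm_smul_vecMulVec_sub_sq, mul_pow, mul_pow, Real.sq_sqrt zero_le_two,
      norm_sub_sq_real, hφ]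
    ring
  have hnonneg : 0 ≤ 2 * ‖ψ‖ ^ 2 * (‖ψ‖ ^ 2 - inner ℝ φ ψ) ^ 2 := by positivity
  linarith

theorem IsScalable.exists_norm_frameOperator_sub_one_sq_le (hΨ : IsScalable Ψ)
    (hΦ : ∀ i, ‖Φ i‖ = 1) :
    ∃ e : Fin M → ℝ, (∀ i, 0 ≤ e i) ∧ ∑ i, e i = N ∧
      ‖frameOperator e Φ - 1‖ ^ 2 ≤ 2 * (N * frobeniusNorm (Φ - Ψ) ^ 2) := by
  obtain ⟨c, hc, hcΨ⟩ := isScalable_iff.1 hΨ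
  set e : Fin M → ℝ := fun i => c i * ‖Ψ i‖ ^ 2
  have he : ∀ i, 0 ≤ e i := fun i => mul_nonneg (hc i) (sq_nonneg _)
  have hsum : ∑ i, e i = N := sum_mul_norm_sq_eq hcΨ
  have hsq : ∑ i, e i ^ 2 ≤ N := hsum ▸ Finset.sum_le_sum fun i _ =>
    pow_le_of_le_one (he i) (mul_norm_sq_le_one hc hcΨ i) two_ne_zero
  have hnorm : ‖frameOperator e Φ - 1‖ ≤ ∑ i, e i * (√2 * ‖(Φ - Ψ) i‖) := by
    rw [← hcΨ, frameOperator, frameOperator, ← Finset.sum_sub_distrib]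
    refine norm_sum_le_of_le _ fun i _ => ?_
    rw [mul_smul, ← smul_sub, norm_smul, Real.norm_of_nonneg (hc i), mul_assoc]
    exact mul_le_mul_of_nonneg_left (norm_smul_vecMulVec_sub_le (hΦ i) (Ψ i)) (hc i)
  refine ⟨e, he, hsum, ?_⟩
  calc ‖frameOperator e Φ - 1‖ ^ 2
      ≤ (∑ i, e i * (√2 * ‖(Φ - Ψ) i‖)) ^ 2 := by gcongr
    _ ≤ (∑ i, e i ^ 2) * ∑ i, (√2 * ‖(Φ - Ψ) i‖) ^ 2 := Finset.sum_mul_sq_le_sq_mul_sq _ _ _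
    _ ≤ N * ∑ i, (√2 * ‖(Φ - Ψ) i‖) ^ 2 := by gcongr
    _ = 2 * (N * frobeniusNorm (Φ - Ψ) ^ 2) := by
        rw [frobeniusNorm, Real.sq_sqrt (by positivity)]
        simp only [mul_pow, Real.sq_sqrt zero_le_two, ← Finset.mul_sum]
        ring

theorem scalableDist_nonneg (Φ : Fin M → EuclideanSpace ℝ (Fin N)) : 0 ≤ scalableDist Φ := by
  refine Real.sInf_nonneg ?_
  rintro r ⟨Ψ, -, rfl⟩
  exact Real.sqrt_nonneg _

theorem one_sub_le_det_inv_of_isScalable (hX : X.PosDef) (hXΦ : Encloses X Φ)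
    (hΦ : ∀ i, ‖Φ i‖ = 1) (hΨ : IsScalable Ψ) :
    1 - 2 * (N * frobeniusNorm (Φ - Ψ) ^ 2) ≤ X⁻¹.det := by
  obtain ⟨e, he, hsum, hle⟩ := hΨ.exists_norm_frameOperator_sub_one_sq_le hΦ
  calc 1 - 2 * (N * frobeniusNorm (Φ - Ψ) ^ 2)
      ≤ 1 - ‖frameOperator e Φ - 1‖ ^ 2 := by linarith
    _ ≤ (frameOperator e Φ).det :=
        one_sub_norm_sub_one_sq_le_det (posSemidef_frameOperator he Φ) (by
          simpa [trace_frameOperator, hΦ] using hsum)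
    _ ≤ X⁻¹.det := by
        rw [det_nonsing_inv, Ring.inverse_eq_inv', ← one_div, le_div_iff₀' hX.det_pos]
        exact det_mul_det_frameOperator_le_one hX.posSemidef hXΦ he (by simpa using hsum)

theorem one_sub_scalableDist_sq_le_det_inv (hX : X.PosDef) (hXΦ : Encloses X Φ)
    (hΦ : ∀ i, ‖Φ i‖ = 1) (hΨ : IsScalable Ψ) :
    1 - 2 * (N * scalableDist Φ ^ 2) ≤ X⁻¹.det := by
  rcases N.eq_zero_or_pos with rfl | hN
  · simp
  have hN₀ : (0 : ℝ) < 2 * N := by positivity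
  suffices h : √((1 - X⁻¹.det) / (2 * N)) ≤ scalableDist Φ by
    rw [Real.sqrt_le_left (scalableDist_nonneg Φ), div_le_iff₀ hN₀] at h
    linarith
  refine le_csInf ⟨_, Ψ, hΨ, rfl⟩ ?_
  rintro r ⟨Θ, hΘ, rfl⟩
  have hr : 0 ≤ frobeniusNorm (Φ - Θ) := Real.sqrt_nonneg _
  refine (Real.sqrt_le_left hr).2 ((div_le_iff₀ hN₀).2 ?_)
  linarith [one_sub_le_det_inv_of_isScalable hX hXΦ hΦ hΘ]

end Distance

section ErrorBound

variable {N K : ℕ} {d : ℝ}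

theorem two_mul_sqrt_mul_le (hd : d ≤ 1 / 2 * (1 + √(K : ℝ))⁻¹) :
    2 * (√(K : ℝ) * d) ≤ 1 - 2 * d := by
  have hpos : 0 < 1 + √(K : ℝ) := by positivity
  rw [← div_eq_mul_inv, le_div_iff₀ hpos] at hd
  linarith

theorem boundNum_pos (hd₀ : 0 ≤ d) (hd : d ≤ 1 / 2 * (1 + √(K : ℝ))⁻¹) : 0 < boundNum K d := by
  have hlt : 2 * (√(K : ℝ) * d) < (1 - d) ^ 2 := by
    rcases hd₀.eq_or_lt with rfl | hpos
    · norm_num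
    · calc 2 * (√(K : ℝ) * d) ≤ 1 - 2 * d := two_mul_sqrt_mul_le hd
        _ < 1 - 2 * d + d ^ 2 := lt_add_of_pos_right _ (by positivity)
        _ = (1 - d) ^ 2 := by ring
  have hsq : (2 * (√(K : ℝ) * d)) ^ 2 = 4 * K * d ^ 2 := by
    rw [mul_pow, mul_pow, Real.sq_sqrt (Nat.cast_nonneg K)]
    ring
  calc 0 < ((1 - d) ^ 2) ^ 2 - (2 * (√(K : ℝ) * d)) ^ 2 := sub_pos.2 (by gcongr)
    _ = boundNum K d := by rw [hsq, boundNum, ← pow_mul]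

theorem boundNum_le_boundDen (hN : 1 ≤ N) (K : ℕ) (d : ℝ) : boundNum K d ≤ boundDen K N d := by
  have hN' : (1 : ℝ) ≤ N := by exact_mod_cast hN
  exact sub_le_sub_right (le_mul_of_one_le_left (by positivity) hN') _

theorem boundDen_pos (hN : 1 ≤ N) (hd₀ : 0 ≤ d) (hd : d ≤ 1 / 2 * (1 + √(K : ℝ))⁻¹) :
    0 < boundDen K N d :=
  (boundNum_pos hd₀ hd).trans_le (boundNum_le_boundDen hN K d)

theorem one_sub_mul_boundNum_div_boundDen (h : boundDen K N d ≠ 0) :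
    1 - N * (boundNum K d / boundDen K N d) = 4 * (N - 1) * (K * d ^ 2) / boundDen K N d := by
  rw [← mul_div_assoc, one_sub_div h]
  simp only [boundNum, boundDen]
  ring

theorem mul_boundNum_div_boundDen_le_one (hN : 1 ≤ N) (hd₀ : 0 ≤ d)
    (hd : d ≤ 1 / 2 * (1 + √(K : ℝ))⁻¹) : N * (boundNum K d / boundDen K N d) ≤ 1 := by
  have hN' : (0 : ℝ) ≤ N - 1 := sub_nonneg.2 (by exact_mod_cast hN)
  have hden := boundDen_pos hN hd₀ hd
  rw [← sub_nonneg, one_sub_mul_boundNum_div_boundDen hden.ne']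
  positivity

theorem le_one_div_four (hK : 1 ≤ K) (hd : d ≤ 1 / 2 * (1 + √(K : ℝ))⁻¹) : d ≤ 1 / 4 := by
  have hsqrt : (1 : ℝ) ≤ √(K : ℝ) := Real.one_le_sqrt.2 (by exact_mod_cast hK)
  have hinv : (1 + √(K : ℝ))⁻¹ ≤ 2⁻¹ := inv_anti₀ two_pos (by linarith)
  linarith

theorem one_sub_mul_boundNum_div_boundDen_le (hN : 1 ≤ N) (hK : 1 ≤ K) (hd₀ : 0 ≤ d)
    (hd : d ≤ 1 / 2 * (1 + √(K : ℝ))⁻¹) :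
    1 - N * (boundNum K d / boundDen K N d) ≤ 16 * (K * d ^ 2) := by
  have hN' : (0 : ℝ) ≤ N - 1 := sub_nonneg.2 (by exact_mod_cast hN)
  have hden := boundDen_pos hN hd₀ hd
  have hpow : (1 / 4 : ℝ) ≤ (1 - d) ^ 4 :=
    calc (1 / 4 : ℝ) ≤ (3 / 4) ^ 4 := by norm_num
      _ ≤ (1 - d) ^ 4 := by gcongr; linarith [le_one_div_four hK hd]
  have hden' : (N - 1 : ℝ) ≤ 4 * boundDen K N d :=
    calc (N - 1 : ℝ) = 4 * ((N - 1) * (1 / 4)) := by ring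
      _ ≤ 4 * ((N - 1) * (1 - d) ^ 4) := by gcongr
      _ ≤ 4 * ((N - 1) * (1 - d) ^ 4 + boundNum K d) := by linarith [boundNum_pos hd₀ hd]
      _ = 4 * boundDen K N d := by rw [boundNum, boundDen]; ring
  rw [one_sub_mul_boundNum_div_boundDen hden.ne', div_le_iff₀ hden]
  calc 4 * (N - 1) * (K * d ^ 2) ≤ 4 * (4 * boundDen K N d) * (K * d ^ 2) := by gcongr
    _ = 16 * (K * d ^ 2) * boundDen K N d := by ring

theorem errorBound_le (hN : 1 ≤ N) (hK : 1 ≤ K) (hd₀ : 0 ≤ d)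
    (hd : d ≤ 1 / 2 * (1 + √(K : ℝ))⁻¹) : errorBound K N d ≤ 4 * (K * √(N : ℝ) * d) := by
  have hle := one_sub_mul_boundNum_div_boundDen_le hN hK hd₀ hd
  have hone := mul_boundNum_div_boundDen_le_one hN hd₀ hd
  have hnonneg : 0 ≤ N * (boundNum K d / boundDen K N d) := by
    have := boundNum_pos hd₀ hd
    have := boundDen_pos hN hd₀ hd
    positivity
  rw [errorBound]
  set t := N * (boundNum K d / boundDen K N d)
  have hdefect : √(1 - √t) ≤ 4 * (√(K : ℝ) * d) := by
    rw [Real.sqrt_le_left (by positivity)]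
    calc 1 - √t ≤ 1 - t :=
          sub_le_sub_left (Real.le_sqrt_of_sq_le (pow_le_of_le_one hnonneg hone two_ne_zero)) 1
      _ ≤ 16 * (K * d ^ 2) := hle
      _ = (4 * (√(K : ℝ) * d)) ^ 2 := by
          rw [mul_pow, mul_pow, Real.sq_sqrt (Nat.cast_nonneg K)]
          ring
  calc √(K * N : ℝ) * √(1 - √t) ≤ √(K * N : ℝ) * (4 * (√(K : ℝ) * d)) := by gcongr
    _ = 4 * ((√(K : ℝ) * √(K : ℝ)) * √(N : ℝ) * d) := by
        rw [Real.sqrt_mul (Nat.cast_nonneg K)]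
        ring
    _ = 4 * (K * √(N : ℝ) * d) := by rw [Real.mul_self_sqrt (Nat.cast_nonneg K)]

theorem two_mul_sq_le_one_sub_mul_boundNum_div_boundDen (hN : 2 ≤ N) (hNK : N ≤ K)
    (hd₀ : 0 ≤ d) (hd : d ≤ 1 / 2 * (1 + √(K : ℝ))⁻¹) :
    2 * (N * d ^ 2) ≤ 1 - N * (boundNum K d / boundDen K N d) := by
  have hN' : (2 : ℝ) ≤ N := by exact_mod_cast hN
  have hden := boundDen_pos (show 1 ≤ N by lia) hd₀ hd
  have hd₁ := le_one_div_four (show 1 ≤ K by lia) hd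
  have hden' : boundDen K N d ≤ N :=
    calc boundDen K N d ≤ N * (1 - d) ^ 4 := sub_le_self _ (by positivity)
      _ ≤ N := mul_le_of_le_one_right (by positivity) (pow_le_one₀ (by linarith) (by linarith))
  rw [one_sub_mul_boundNum_div_boundDen hden.ne', le_div_iff₀ hden]
  calc 2 * (N * d ^ 2) * boundDen K N d ≤ 2 * (N * d ^ 2) * N := by gcongr
    _ = 2 * N * (N * d ^ 2) := by ring
    _ ≤ 4 * (N - 1) * (K * d ^ 2) := by
        have hcoeff : (2 * N : ℝ) ≤ 4 * (N - 1) := by linarith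
        exact mul_le_mul hcoeff (by gcongr) (by positivity) (by linarith)

end ErrorBound

section Approximation

variable {M N : ℕ} {Φ : Fin M → EuclideanSpace ℝ (Fin N)} {X : Matrix (Fin N) (Fin N) ℝ}

open scoped Matrix.Norms.Frobenius in
theorem norm_smul_sqrt_sub_sq_le {n : Type*} [Fintype n] [DecidableEq n] {X : Matrix n n ℝ}
    (hX : X.PosDef) (htr : X⁻¹.trace = Fintype.card n) {v : ℝ} (hv : 0 < v)
    (hvdet : v ^ Fintype.card n = (√X.det)⁻¹) {φ : EuclideanSpace ℝ n}
    (hφ : φ.ofLp ⬝ᵥ X *ᵥ φ.ofLp = 1) :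
    ‖v • toEuclideanLin (CFC.sqrt X) φ - φ‖ ^ 2 ≤ Fintype.card n * (1 - v ^ 2) := by
  set R := CFC.sqrt X
  have hR : IsUnit R.det := (isUnit_iff_isUnit_det _).1 (posDef_sqrt hX).isUnit
  have hsymm : R⁻¹.IsSymm := by rw [IsSymm, transpose_nonsing_inv, transpose_sqrt]
  have hsq : R⁻¹ * R⁻¹ = X⁻¹ := by rw [← Matrix.mul_inv_rev, sqrt_mul_sqrt hX.posSemidef]
  have htrace : Fintype.card n * v ≤ R⁻¹.trace :=
    card_mul_le_trace_of_det_eq_pow (posDef_sqrt hX).inv.posSemidef hv (by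
      rw [hvdet, det_nonsing_inv, Ring.inverse_eq_inv', det_sqrt hX.posSemidef])
  have hunit : ‖toEuclideanLin R φ‖ = 1 := by
    rw [← sq_eq_sq₀ (norm_nonneg _) zero_le_one, norm_toEuclideanLin_sqrt_sq hX.posSemidef, hφ,
      one_pow]
  have hdiff : v • toEuclideanLin R φ - φ =
      toEuclideanLin (v • 1 - R⁻¹) (toEuclideanLin R φ) := by
    ext1
    simp [toLpLin_apply, nonsing_inv_mul _ hR]
  calc ‖v • toEuclideanLin R φ - φ‖ ^ 2
      ≤ (‖v • 1 - R⁻¹‖ * ‖toEuclideanLin R φ‖) ^ 2 := by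
        rw [hdiff]
        gcongr
        exact norm_toEuclideanLin_le _ _
    _ = Fintype.card n * v ^ 2 - 2 * v * R⁻¹.trace + Fintype.card n := by
        rw [hunit, mul_one, frobenius_norm_smul_one_sub_sq hsymm, hsq, htr]
    _ ≤ Fintype.card n * (1 - v ^ 2) := by nlinarith

theorem sqrt_mul_boundNum_div_boundDen_le_sq (hN : 1 ≤ N) (hΦ : ∀ i, ‖Φ i‖ = 1)
    {Ψ : Fin M → EuclideanSpace ℝ (Fin N)} (hΨ : IsScalable Ψ)
    (hd : scalableDist Φ ≤ 1 / 2 * (1 + √(numK M N : ℝ))⁻¹)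
    (hX : X.PosDef) (hXΦ : Encloses X Φ) (htr : X⁻¹.trace = N) {v : ℝ} (hv : 0 < v)
    (hvdet : v ^ N = (√X.det)⁻¹) :
    √(N * (boundNum (numK M N) (scalableDist Φ) / boundDen (numK M N) N (scalableDist Φ))) ≤
      v ^ 2 := by
  have hd₀ := scalableDist_nonneg Φ
  have hdet : v ^ N = √X⁻¹.det := by
    rw [hvdet, det_nonsing_inv, Ring.inverse_eq_inv', Real.sqrt_inv]
  rcases hN.eq_or_lt with rfl | hN₂
  · have hdet₁ : X⁻¹.det = 1 := by
      rw [det_fin_one]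
      simpa [trace] using htr
    rw [hdet₁, Real.sqrt_one, pow_one] at hdet
    rw [hdet, one_pow, Real.sqrt_le_one]
    exact mul_boundNum_div_boundDen_le_one le_rfl hd₀ hd
  · have hv₁ : v ≤ 1 := by
      rw [← pow_le_one_iff_of_nonneg hv.le (by lia : N ≠ 0), hdet, Real.sqrt_le_one]
      exact det_le_one_of_trace_le hX.inv.posSemidef (by simp [htr])
    calc √(N * (boundNum (numK M N) (scalableDist Φ) / boundDen (numK M N) N (scalableDist Φ)))
        ≤ √X⁻¹.det := Real.sqrt_le_sqrt (by
          linarith [two_mul_sq_le_one_sub_mul_boundNum_div_boundDen hN₂ (hΨ.le_numK hN) hd₀ hd,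
            one_sub_scalableDist_sq_le_det_inv hX hXΦ hΦ hΨ])
      _ = v ^ N := hdet.symm
      _ ≤ v ^ 2 := pow_le_pow_of_le_one hv.le hv₁ hN₂

theorem frobeniusNorm_approxFrame_sub_le (hN : 1 ≤ N) (hΦ : ∀ i, ‖Φ i‖ = 1)
    (hd : scalableDist Φ ≤ 1 / 2 * (1 + √(numK M N : ℝ))⁻¹)
    (hX : X.PosDef) (hXΦ : Encloses X Φ) (htr : X⁻¹.trace = N) {ρ : Fin M → ℝ}
    (hρ : IsWeight Φ X ρ) :
    frobeniusNorm (approxFrame Φ X ρ - Φ) ≤ errorBound (numK M N) N (scalableDist Φ) := by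
  classical
  have hV : 0 < normalizedVolume (ellipsoid X 0) := by
    rw [normalizedVolume_ellipsoid hX]
    exact inv_pos.2 (Real.sqrt_pos.2 hX.det_pos)
  have hv := Real.rpow_pos_of_pos hV (1 / (N : ℝ))
  have hvdet : (normalizedVolume (ellipsoid X 0) ^ (1 / (N : ℝ))) ^ N = (√X.det)⁻¹ := by
    rw [one_div, Real.rpow_inv_natCast_pow hV.le (by lia), normalizedVolume_ellipsoid hX]
  have hle := sqrt_mul_boundNum_div_boundDen_le_sq hN hΦ (isScalable_approxFrame hX hρ) hd hX
    hXΦ htr hv hvdet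
  have hone := mul_boundNum_div_boundDen_le_one hN (scalableDist_nonneg Φ) hd
  rw [frobeniusNorm, errorBound, ← Real.sqrt_mul (by positivity)]
  set v := normalizedVolume (ellipsoid X 0) ^ (1 / (N : ℝ)) with hv_def
  set t := N * (boundNum (numK M N) (scalableDist Φ) / boundDen (numK M N) N (scalableDist Φ))
  have ht : 0 ≤ 1 - √t := sub_nonneg.2 (Real.sqrt_le_one.2 hone)
  have hterm : ∀ i, ‖(approxFrame Φ X ρ - Φ) i‖ ^ 2 ≤ if 0 < ρ i then N * (1 - √t) else 0 := by
    intro i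
    rw [Pi.sub_apply, approxFrame, ← hv_def]
    split_ifs with hi
    · have hφ := dotProduct_mulVec_eq_one_of_isWeight hΦ hX hXΦ htr hρ hi
      have hnorm := norm_smul_sqrt_sub_sq_le hX (by simpa using htr) hv (by simpa using hvdet) hφ
      rw [Fintype.card_fin] at hnorm
      exact hnorm.trans (by gcongr)
    · simp
  refine Real.sqrt_le_sqrt ?_
  calc ∑ i, ‖(approxFrame Φ X ρ - Φ) i‖ ^ 2
      ≤ ∑ i, if 0 < ρ i then N * (1 - √t) else 0 := Finset.sum_le_sum fun i _ => hterm i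
    _ = (Finset.univ.filter fun i => 0 < ρ i).card * (N * (1 - √t)) := by
        rw [← Finset.sum_filter, Finset.sum_const, nsmul_eq_mul]
    _ ≤ numK M N * (N * (1 - √t)) := by
        gcongr
        convert hρ.card_le
    _ = numK M N * N * (1 - √t) := by ring

end Approximation

end ScalableFrames

theorem theorem3p4 :
    ∃ C : ℝ, 0 < C ∧
      ∀ (M N : ℕ) (Φ : Fin M → EuclideanSpace ℝ (Fin N)), 1 ≤ N →
        ScalableFrames.IsUnitNormFrame Φ →
        ScalableFrames.scalableDist Φ ≤
          1 / 2 * (1 + Real.sqrt (ScalableFrames.numK M N : ℝ))⁻¹ →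
        -- the bound is meaningful, and it is `K √N O(d_Φ)` with an absolute constant
        (0 < ScalableFrames.boundNum (ScalableFrames.numK M N) (ScalableFrames.scalableDist Φ) ∧
          0 < ScalableFrames.boundDen (ScalableFrames.numK M N) N
            (ScalableFrames.scalableDist Φ) ∧
          Real.sqrt (N *
            (ScalableFrames.boundNum (ScalableFrames.numK M N) (ScalableFrames.scalableDist Φ) /
              ScalableFrames.boundDen (ScalableFrames.numK M N) N
                (ScalableFrames.scalableDist Φ))) ≤ 1 ∧
          ScalableFrames.errorBound (ScalableFrames.numK M N) N (ScalableFrames.scalableDist Φ) ≤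
            C * (ScalableFrames.numK M N * Real.sqrt N * ScalableFrames.scalableDist Φ)) ∧
        -- the minimal ellipsoid `E(X)` of `Φ` exists
        (∃ X : Matrix (Fin N) (Fin N) ℝ, X.PosDef ∧
          ScalableFrames.IsMinimalEllipsoidOf Φ (ScalableFrames.ellipsoid X 0)) ∧
        ∀ X : Matrix (Fin N) (Fin N) ℝ, X.PosDef →
          ScalableFrames.IsMinimalEllipsoidOf Φ (ScalableFrames.ellipsoid X 0) →
          -- weights `ρ` exist, and every choice of them gives a good scalable approximation
          (∃ ρ : Fin M → ℝ, ScalableFrames.IsWeight Φ X ρ) ∧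
          ∀ ρ : Fin M → ℝ, ScalableFrames.IsWeight Φ X ρ →
            ScalableFrames.IsScalable (ScalableFrames.approxFrame Φ X ρ) ∧
            ScalableFrames.frobeniusNorm (ScalableFrames.approxFrame Φ X ρ - Φ) ≤
              ScalableFrames.errorBound (ScalableFrames.numK M N) N
                (ScalableFrames.scalableDist Φ) := by
  refine ⟨4, four_pos, fun M N Φ hN hΦ hd => ?_⟩
  have hd₀ := ScalableFrames.scalableDist_nonneg Φ
  obtain ⟨X₀, hX₀, hmin₀⟩ := ScalableFrames.exists_isMinimalEllipsoidOf hN hΦ.1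
  obtain ⟨ρ₀, hρ₀⟩ := ScalableFrames.exists_isWeight hN hΦ hX₀ hmin₀
  have hK : 1 ≤ ScalableFrames.numK M N :=
    hN.trans ((ScalableFrames.isScalable_approxFrame hX₀ hρ₀).le_numK hN)
  refine ⟨⟨ScalableFrames.boundNum_pos hd₀ hd, ScalableFrames.boundDen_pos hN hd₀ hd,
    Real.sqrt_le_one.2 (ScalableFrames.mul_boundNum_div_boundDen_le_one hN hd₀ hd),
    ScalableFrames.errorBound_le hN hK hd₀ hd⟩, ⟨X₀, hX₀, hmin₀⟩, fun X hX hmin => ?_⟩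
  have hXΦ := ((ScalableFrames.isMinimalEllipsoidOf_ellipsoid_iff hX).1 hmin).1
  have htr := ScalableFrames.trace_inv_of_isMinimalEllipsoidOf hN hΦ hX hmin
  exact ⟨ScalableFrames.exists_isWeight hN hΦ hX hmin, fun ρ hρ =>
    ⟨ScalableFrames.isScalable_approxFrame hX hρ,
      ScalableFrames.frobeniusNorm_approxFrame_sub_le hN hΦ.2 hd hX hXΦ htr hρ⟩⟩
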